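/- **Setting.** Let $n\ge 2$ and let $M$ be an MDP with deterministic dynamics, initial state $s_0$ and $n$ collectible rewards: the reward of $M$ is $\sum_{i=1}^n R_i$, where $R_i$ equals $1$ at one state $s_i$ and $0$ elsewhere, and each reward can be collected only once. Let $d_{i,j}$ ($0\le i\le n$, $1\le j\le n$) be the length (number of steps) of a shortest path from $s_i$ to $s_j$. Assume that the associated graph is undirected: every $s_j$ can be reached from $s_0$ and from every $s_i$, and $d_{i,j}=d_{j,i}$ for $1\le i,j\le n$. Let $0<\gamma<1$ be the discount factor. A policy makes a walk on the nodes $s_0,s_1,\dots,s_n$ starting at $s_0$, in which moving from $s_i$ to $s_j$ takes time $d_{i,j}$; its return is $\sum_j\gamma^{t_j}$, where $t_j$ is the time of the first visit of the walk to $s_j$ (rewards $j$ that the walk does not visit contribute $0$). Let $$\mathrm{OPT}=\max_{\pi\in \mathrm{perm}\{1,\dots,n\}}\ \sum_{j=1}^{n}\gamma^{\,d_{0,\pi_1}+d_{\pi_1,\pi_2}+\dots+d_{\pi_{j-1},\pi_j}} .$$ **Policy.** NN repeatedly goes from the current node to the nearest reward not yet collected. NN-RDFS, with probability $1/2$, runs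 NN from $s_0$. With probability $1/2$ it goes first to a uniformly random reward $s$, draws independently $i$ uniformly from $\{1,\dots,\lfloor\log_2 n\rfloor\}$, sets $\theta=x/\sqrt{n/2^i}$ with $x=\log_{1/\gamma}2$, and runs a depth first search from $s$ on the edges shorter than $\theta$: from the current reward it goes to the nearest not yet visited reward at distance less than $\theta$ if there is one, and otherwise walks back to the reward from which the current one was discovered, until it is back at $s$ with no such reward left. Then it continues with NN until all rewards are collected. Ties among nearest rewards are broken by an arbitrary rule, which may depend on the walk so far. Let $\text{NN-RDFS}$ denote the expected return. **Theorem (NN-RDFS Performance).** 1. For every $\alpha>0$ there is a constant $c=c(\alpha)>0$ such that for all $n\ge 2$, all $M$, all $\gamma\in(0,1)$ and all tie-breaking rules as above, if $\mathrm{OPT}\ge\alpha n$, then $$\text{NN-RDFS}\ \ge\ c\,\frac{n^{-1/2}}{\log^2 n}\,\mathrm{OPT}.$$ 2. There is an absolute constant $c>0$ such that for all $n\ge 2$, all $M$, all $\gamma\in(0,1)$ and all tie-breaking rules as above, $$\text{NN-RDFS}\ \ge\ c\,\frac{n^{-2/3}}{\log^2 n}\,\mathrm{OPT}.$$ -/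

import Mathlib

universe u v

/-- A deterministic MDP with `n` collectible rewards: `step` is the deterministic transition
function, and the `i`-th local reward is worth `1` in the state `rewardState i`, `0` in all other
states, and can be collected only once. The reward of the MDP is the sum of the local rewards. -/
structure CollectibleMDP (n : ℕ) where
  State : Type u
  Action : Type v
  step : State → Action → State
  start : State
  rewardState : Fin n → State

namespace CollectibleMDP

variable {n : ℕ}

/-- The state reached from `s` by a finite sequence of actions. -/
def run (M : CollectibleMDP.{u, v} n) (s : M.State) (l : List M.Action) : M.State :=
  l.foldl M.step s

/-- `t` can be reached from `s`. -/
def Reaches (M : CollectibleMDP.{u, v} n) (s t : M.State) : Prop :=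
  ∃ l : List M.Action, M.run s l = t

/-- The length (number of time steps) of a shortest path from `s` to `t`.
It is meaningful when `t` can be reached from `s`. -/
noncomputable def pathLength (M : CollectibleMDP.{u, v} n) (s t : M.State) : ℕ :=
  sInf {k : ℕ | ∃ l : List M.Action, l.length = k ∧ M.run s l = t}

/-- The states that are nodes of the associated graph: `none` stands for the initial state,
`some i` for the state of the `i`-th reward. -/
def nodeState (M : CollectibleMDP.{u, v} n) : Option (Fin n) → M.State
  | none => M.start
  | some i => M.rewardState i

/-- The length of the edge from the node `a` to the `j`-th reward: the time that the optimal
option for the `j`-th reward takes when it is started at `a`. -/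
noncomputable def edge (M : CollectibleMDP.{u, v} n) (a : Option (Fin n)) (j : Fin n) : ℕ :=
  M.pathLength (M.nodeState a) (M.rewardState j)

end CollectibleMDP

/-! The reward-discounted travelling salesman problem. `d a j` is the length of the edge from the
node `a` (`none` is the initial node) to the `j`-th reward. A walk is the list of the rewards it
visits, in chronological order and possibly with repetitions; it starts at the initial node, which
is not listed. -/
namespace RDTSP

variable {n : ℕ}

/-- The total length of the walk `l` when it is started at the node `a`. -/
def walkLength (d : Option (Fin n) → Fin n → ℕ) : Option (Fin n) → List (Fin n) → ℕ
  | _, [] => 0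
  | a, j :: l => d a j + walkLength d (some j) l

/-- The time at which the walk `w` visits the reward `j` for the first time
(used only for `j ∈ w`). -/
def arrival (d : Option (Fin n) → Fin n → ℕ) (w : List (Fin n)) (j : Fin n) : ℕ :=
  walkLength d none (w.take (w.idxOf j + 1))

/-- The discounted return of a walk: each reward counts once, at its first visit. -/
noncomputable def discountedReturn (γ : ℝ) (d : Option (Fin n) → Fin n → ℕ)
    (w : List (Fin n)) : ℝ :=
  ∑ j : Fin n, if j ∈ w then γ ^ arrival d w j else 0

/-- The optimal discounted return over all orders in which the rewards can be collected. -/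
noncomputable def opt (γ : ℝ) (d : Option (Fin n) → Fin n → ℕ) : ℝ :=
  Finset.univ.sup' Finset.univ_nonempty
    fun σ : Equiv.Perm (Fin n) => discountedReturn γ d (List.ofFn fun t => σ t)

/-- A reward of `U` that is nearest to the node `a`, or `none` if `U` is empty. Ties are broken by
`tie`, which may depend on the walk `h` made so far. -/
def nearest (d : Option (Fin n) → Fin n → ℕ) (tie : List (Fin n) → Finset (Fin n) → Fin n)
    (h : List (Fin n)) (a : Option (Fin n)) (U : Finset (Fin n)) : Option (Fin n) :=
  if U.Nonempty then some (tie h (U.filter fun j => ∀ k ∈ U, d a j ≤ d a k)) else none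

/-- Nearest neighbour: extend the walk `h`, from its current endpoint (`h.getLast?`, which is the
initial node if `h` is empty), by repeatedly going to the nearest reward not yet collected. The
first argument bounds the number of steps; `n` steps collect everything. -/
def nn (d : Option (Fin n) → Fin n → ℕ) (tie : List (Fin n) → Finset (Fin n) → Fin n) :
    ℕ → List (Fin n) → List (Fin n)
  | 0, h => h
  | k + 1, h =>
    match nearest d tie h h.getLast? (Finset.univ.filter fun j => j ∉ h) with
    | none => h
    | some j => nn d tie k (h ++ [j])

/-- Depth first search on the edges shorter than `θ`, nearest first. The second argument is the
stack (current reward on top), the third one the walk so far. At the reward `u`, go to the nearest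
reward not yet visited whose edge from `u` is shorter than `θ`, if there is one; otherwise walk back
to the reward from which `u` was discovered, and stop if `u` is the root. The first
argument bounds the number of steps; `2 * n` steps suffice, since every reward is entered and
left by at most one tree edge. -/
noncomputable def dfs (d : Option (Fin n) → Fin n → ℕ)
    (tie : List (Fin n) → Finset (Fin n) → Fin n) (θ : ℝ) :
    ℕ → List (Fin n) → List (Fin n) → List (Fin n)
  | 0, _, h => h
  | _ + 1, [], h => h
  | k + 1, u :: s, h =>
    match nearest d tie h (some u)
        (Finset.univ.filter fun j => j ∉ h ∧ (d (some u) j : ℝ) < θ) with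
    | some j => dfs d tie θ k (j :: u :: s) (h ++ [j])
    | none =>
      match s with
      | [] => h
      | p :: s' => dfs d tie θ k (p :: s') (h ++ [p])

/-- The walk of the nearest neighbour policy. -/
def nnWalk (d : Option (Fin n) → Fin n → ℕ) (tie : List (Fin n) → Finset (Fin n) → Fin n) :
    List (Fin n) :=
  nn d tie n []

/-- The walk of RDFS when the first reward is `s₁` and the threshold is `θ`: go to `s₁`, run depth
first search from there, and continue with nearest neighbour. -/
noncomputable def rdfsWalk (d : Option (Fin n) → Fin n → ℕ)
    (tie : List (Fin n) → Finset (Fin n) → Fin n) (θ : ℝ) (s₁ : Fin n) : List (Fin n) :=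
  nn d tie n (dfs d tie θ (2 * n) [s₁] [s₁])

/-- The threshold for the guess `n / 2 ^ i` of the number of rewards collected by the optimum:
`x / √(n / 2 ^ i)`, where `x = log_{1/γ} 2`. -/
noncomputable def threshold (n : ℕ) (γ : ℝ) (i : ℕ) : ℝ :=
  Real.logb (1 / γ) 2 / √((n : ℝ) / 2 ^ i)

/-- The expected return of NN-RDFS: with probability `1/2` run nearest neighbour; with probability
`1/2` run RDFS with `s₁` uniform among the `n` rewards and, independently, `i` uniform in
`{1, …, ⌊log₂ n⌋}`. -/
noncomputable def nnRDFS (γ : ℝ) (d : Option (Fin n) → Fin n → ℕ)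
    (tie : List (Fin n) → Finset (Fin n) → Fin n) : ℝ :=
  1 / 2 * discountedReturn γ d (nnWalk d tie) +
    1 / 2 * ((1 / (n : ℝ)) * ∑ s₁ : Fin n,
      (1 / (Nat.log 2 n : ℝ)) * ∑ i ∈ Finset.Icc 1 (Nat.log 2 n),
        discountedReturn γ d (rdfsWalk d tie (threshold n γ i) s₁))

end RDTSP

namespace CollectibleMDP

variable {n : ℕ}

/-- Every reward can be reached from the initial state and from every other reward, and travel
times between rewards are symmetric (the associated graph is undirected). -/
structure Undirected (M : CollectibleMDP.{u, v} n) : Prop where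
  reaches_start : ∀ i, M.Reaches M.start (M.rewardState i)
  reaches : ∀ i j, M.Reaches (M.rewardState i) (M.rewardState j)
  symm : ∀ i j, M.pathLength (M.rewardState i) (M.rewardState j) =
    M.pathLength (M.rewardState j) (M.rewardState i)

/-- The value of the optimal solution. -/
noncomputable def OPT (M : CollectibleMDP.{u, v} n) (γ : ℝ) : ℝ :=
  RDTSP.opt γ M.edge

/-- The expected return of NN-RDFS on `M`, with ties among nearest rewards broken by `tie`. -/
noncomputable def NNRDFS (M : CollectibleMDP.{u, v} n) (γ : ℝ)
    (tie : List (Fin n) → Finset (Fin n) → Fin n) : ℝ :=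
  RDTSP.nnRDFS γ M.edge tie

end CollectibleMDP

/-!
An optimal order of collection visits reward `j` at a time `t j`, and the triangle inequality gives
`d i j ≤ |t i - t j|` and `d none j ≤ t j`. Let `S` be the set of the `k` rewards visited in a slot
of one half-life that begins at time `τ`. Cut the slot into about `√k` cells, so that rewards of the
same cell are closer than the threshold. On average a reward of `S` shares its cell with about `√k`
others, and a depth first search that starts at it reaches the slot in time and collects about `√k`
rewards within a bounded number of half-lives. A random first reward lies in `S` with probability
`k / n`, and some guess `n / 2 ^ i` is within a factor of two of `k`, whence
`γ ^ τ * k * √k ≤ C * Q`, where `Q = n * log n * R`, `R` is the expected return, and `C` here and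
below stands for an absolute constant.

It follows that the slot contributes `k * γ ^ τ ≤ C * (γ ^ τ * Q ^ 2) ^ (1 / 3)` to the optimum.
The slots are one half-life apart, so these bounds form a geometric series, dominated by its first
term: `OPT ^ 3 ≤ C * γ ^ T * Q ^ 2` if nothing is reached before time `T`. With `T = 0` this is
`OPT ^ (3 / 2) ≤ C * Q`. With `T` the distance to the nearest reward, `γ ^ T` is at most the return
of nearest neighbour, hence at most `2 * R`, and `OPT ≤ C * (n * log n) ^ (2 / 3) * R`.
-/

namespace RDTSP

section Walks

variable {n : ℕ} {d : Option (Fin n) → Fin n → ℕ}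

theorem walkLength_append_cons (d : Option (Fin n) → Fin n → ℕ) (a : Option (Fin n))
    (l₁ : List (Fin n)) (j : Fin n) (l₂ : List (Fin n)) :
    walkLength d a (l₁ ++ j :: l₂) =
      walkLength d a (l₁ ++ [j]) + walkLength d (some j) l₂ := by
  induction l₁ generalizing a with
  | nil => simp [walkLength]
  | cons b l ih => simp [walkLength, ih, add_assoc]

theorem walkLength_le_of_prefix (d : Option (Fin n) → Fin n → ℕ) (a : Option (Fin n))
    {l₁ l₂ : List (Fin n)} (h : l₁ <+: l₂) : walkLength d a l₁ ≤ walkLength d a l₂ := by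
  induction l₁ generalizing a l₂ with
  | nil => simp [walkLength]
  | cons b l ih =>
    obtain ⟨e, rfl⟩ := h
    simpa [walkLength] using ih (some b) (List.prefix_append l e)

theorem edge_le_walkLength (htri : ∀ a j k, d a k ≤ d a j + d (some j) k) (a : Option (Fin n))
    (l : List (Fin n)) (j : Fin n) : d a j ≤ walkLength d a (l ++ [j]) := by
  induction l generalizing a with
  | nil => simp [walkLength]
  | cons b l ih =>
    simpa [walkLength] using (htri a b j).trans (Nat.add_le_add_left (ih (some b)) _)

theorem arrival_append_cons (d : Option (Fin n) → Fin n → ℕ) {l₁ : List (Fin n)} {j : Fin n}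
    (hj : j ∉ l₁) (l₂ : List (Fin n)) :
    arrival d (l₁ ++ j :: l₂) j = walkLength d none (l₁ ++ [j]) := by
  have hidx : (l₁ ++ j :: l₂).idxOf j = l₁.length := by simp [List.idxOf_append_of_notMem hj]
  rw [arrival, hidx, List.take_length_add_append, List.take_succ_cons, List.take_zero]

theorem arrival_le_of_prefix (d : Option (Fin n) → Fin n → ℕ) {p w : List (Fin n)}
    (h : p <+: w) {j : Fin n} (hj : j ∈ p) : arrival d w j ≤ walkLength d none p := by
  obtain ⟨e, rfl⟩ := h
  obtain ⟨l₁, l₂, rfl, hj₁⟩ := List.eq_append_cons_of_mem hj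
  rw [List.append_assoc, List.cons_append, arrival_append_cons d hj₁]
  exact walkLength_le_of_prefix d none ⟨l₂, by simp⟩

theorem edge_none_le_arrival (htri : ∀ a j k, d a k ≤ d a j + d (some j) k)
    {w : List (Fin n)} {j : Fin n} (hj : j ∈ w) : d none j ≤ arrival d w j := by
  obtain ⟨l₁, l₂, rfl, hj₁⟩ := List.eq_append_cons_of_mem hj
  rw [arrival_append_cons d hj₁]
  exact edge_le_walkLength htri none l₁ j

theorem arrival_add_edge_le_arrival (htri : ∀ a j k, d a k ≤ d a j + d (some j) k)
    {w : List (Fin n)} {i j : Fin n} (hj : j ∈ w) (hij : w.idxOf i < w.idxOf j) :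
    arrival d w i + d (some i) j ≤ arrival d w j := by
  obtain ⟨l, l₃, rfl, hjl⟩ := List.eq_append_cons_of_mem hj
  have hil : i ∈ l := by
    by_contra hil
    simp [List.idxOf_append_of_notMem hil, List.idxOf_append_of_notMem hjl] at hij
  obtain ⟨l₁, l₂, rfl, hi₁⟩ := List.eq_append_cons_of_mem hil
  rw [arrival_append_cons d hjl, List.append_assoc, List.append_assoc, List.cons_append,
    List.cons_append, arrival_append_cons d hi₁, walkLength_append_cons d none l₁ i (l₂ ++ [j])]
  exact Nat.add_le_add_left (edge_le_walkLength htri _ _ _) _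

/-- `t` assigns to each reward a visiting time, and these times respect the distances `d` from the
start and between rewards, as the first visits of a walk do. -/
structure FeasibleTimes (d : Option (Fin n) → Fin n → ℕ) (t : Fin n → ℕ) : Prop where
  edge_none_le : ∀ j, d none j ≤ t j
  edge_some_le : ∀ i j, i ≠ j → (d (some i) j : ℝ) ≤ |(t i : ℝ) - t j|

theorem feasibleTimes_arrival (htri : ∀ a j k, d a k ≤ d a j + d (some j) k)
    (hsymm : ∀ i j, d (some i) j = d (some j) i) {w : List (Fin n)} (hw : ∀ j, j ∈ w) :
    FeasibleTimes d (arrival d w) where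
  edge_none_le j := edge_none_le_arrival htri (hw j)
  edge_some_le i j hij := by
    wlog hlt : w.idxOf i < w.idxOf j generalizing i j
    · have hne : w.idxOf i ≠ w.idxOf j := fun h => hij ((List.idxOf_inj (hw i)).1 h)
      rw [hsymm, abs_sub_comm]
      exact this j i hij.symm (by omega)
    have harr : (arrival d w i : ℝ) + d (some i) j ≤ arrival d w j := by
      exact_mod_cast arrival_add_edge_le_arrival htri (hw j) hlt
    rw [abs_sub_comm]
    exact (le_sub_iff_add_le'.2 harr).trans (le_abs_self _)

theorem exists_feasibleTimes_opt_eq (γ : ℝ) (htri : ∀ a j k, d a k ≤ d a j + d (some j) k)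
    (hsymm : ∀ i j, d (some i) j = d (some j) i) :
    ∃ t, FeasibleTimes d t ∧ opt γ d = ∑ j, γ ^ t j := by
  obtain ⟨σ, -, hσ⟩ := Finset.exists_mem_eq_sup' (Finset.univ_nonempty (α := Equiv.Perm (Fin n)))
    fun σ : Equiv.Perm (Fin n) => discountedReturn γ d (List.ofFn fun i => σ i)
  have hmem (j : Fin n) : j ∈ List.ofFn fun i => σ i :=
    List.mem_ofFn.2 ⟨σ.symm j, σ.apply_symm_apply j⟩
  refine ⟨_, feasibleTimes_arrival htri hsymm hmem, ?_⟩
  rw [opt, hσ, discountedReturn]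
  exact Finset.sum_congr rfl fun j _ => if_pos (hmem j)

end Walks

section DepthFirstSearch

/-- The states of a depth first search from `s` along the edges `r`: the stack, with the current
vertex first, and the walk made so far. The choice of the next neighbour is left open, and the
search may also backtrack early, so that tie-breaking and the step bound of `dfs` do not matter. -/
inductive DFSState {α : Type*} (r : α → α → Prop) (s : α) : List α → List α → Prop
  | root : DFSState r s [s] [s]
  | descend {u j : α} {stack walk : List α} : DFSState r s (u :: stack) walk → j ∉ walk → r u j →
      DFSState r s (j :: u :: stack) (walk ++ [j])
  | backtrack {u p : α} {stack walk : List α} : DFSState r s (u :: p :: stack) walk →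
      DFSState r s (p :: stack) (walk ++ [p])

namespace DFSState

variable {α : Type*} {r : α → α → Prop} {s : α} {stack walk : List α}

theorem stack_ne_nil (h : DFSState r s stack walk) : stack ≠ [] := by
  cases h <;> simp

theorem stack_subset_walk (h : DFSState r s stack walk) : stack ⊆ walk := by
  induction h with
  | root => simp
  | descend _ _ _ ih => exact List.cons_subset.2 ⟨by simp, List.subset_append_of_subset_left _ ih⟩
  | backtrack _ ih =>
    exact List.subset_append_of_subset_left _ (List.subset_of_cons_subset ih)

theorem getLast?_stack (h : DFSState r s stack walk) : stack.getLast? = some s := by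
  induction h with
  | root => rfl
  | descend _ _ _ ih => simpa using ih
  | backtrack _ ih => simpa using ih

theorem getLast?_walk (h : DFSState r s stack walk) : walk.getLast? = stack.head? := by
  cases h <;> simp

theorem exists_walk_eq_cons (h : DFSState r s stack walk) : ∃ l, walk = s :: l := by
  induction h with
  | root => exact ⟨[], rfl⟩
  | @descend _ j _ _ _ _ _ ih => obtain ⟨l, rfl⟩ := ih; exact ⟨l ++ [j], rfl⟩
  | @backtrack _ p _ _ _ ih => obtain ⟨l, rfl⟩ := ih; exact ⟨l ++ [p], rfl⟩

theorem isChain_stack (hr : ∀ a b, r a b → r b a) (h : DFSState r s stack walk) :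
    stack.IsChain r := by
  induction h with
  | root => simp
  | descend _ _ huj ih => exact ih.cons_cons (hr _ _ huj)
  | backtrack _ ih => exact ih.tail

theorem isChain_walk (hr : ∀ a b, r a b → r b a) (h : DFSState r s stack walk) :
    walk.IsChain r := by
  induction h with
  | root => simp
  | descend h _ huj ih =>
    exact List.isChain_append.2 ⟨ih, by simp, by simpa [h.getLast?_walk] using huj⟩
  | backtrack h ih =>
    have hup := (List.isChain_cons_cons.1 (h.isChain_stack hr)).1
    exact List.isChain_append.2 ⟨ih, by simp, by simpa [h.getLast?_walk] using hup⟩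

variable [DecidableEq α]

/-- Every discovered vertex is entered once and, unless it is still on the stack, left once. -/
theorem length_walk_add_length_stack (h : DFSState r s stack walk) :
    walk.length + stack.length = 2 * walk.toFinset.card := by
  induction h with
  | root => simp
  | @descend _ j _ walk _ hj _ ih =>
    have hcard : (walk ++ [j]).toFinset.card = walk.toFinset.card + 1 := by
      rw [List.toFinset_append, List.toFinset_cons, List.toFinset_nil, insert_empty_eq,
        Finset.union_comm, ← Finset.insert_eq, Finset.card_insert_of_notMem (by simpa using hj)]
    simp only [List.length_append, List.length_cons, List.length_nil] at ih ⊢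
    omega
  | @backtrack _ p _ walk h ih =>
    have hp : p ∈ walk := h.stack_subset_walk (by simp)
    have hset : (walk ++ [p]).toFinset = walk.toFinset := by simpa using hp
    simp only [List.length_append, List.length_cons, List.length_nil, hset] at ih ⊢
    omega

theorem length_lt_two_mul_card_of_prefix (h : DFSState r s stack walk) {p : List α}
    (hp : p <+: walk) (hne : p ≠ []) : p.length < 2 * p.toFinset.card := by
  have length_walk_lt {stack walk : List α} (h : DFSState r s stack walk) :
      walk.length < 2 * walk.toFinset.card := by
    have := h.length_walk_add_length_stack
    have := List.length_pos_iff.2 h.stack_ne_nil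
    omega
  induction h with
  | root =>
    rcases (List.prefix_concat_iff (l₂ := [])).1 hp with rfl | hp
    · simp
    · exact absurd (List.prefix_nil.1 hp) hne
  | descend h hj huj ih =>
    rcases List.prefix_concat_iff.1 hp with rfl | hp
    · exact length_walk_lt (h.descend hj huj)
    · exact ih hp
  | backtrack h ih =>
    rcases List.prefix_concat_iff.1 hp with rfl | hp
    · exact length_walk_lt h.backtrack
    · exact ih hp

end DFSState

variable {n : ℕ} {d : Option (Fin n) → Fin n → ℕ}
  {tie : List (Fin n) → Finset (Fin n) → Fin n}

theorem mem_and_edge_le_of_nearest_eq_some (htie : ∀ h T, T.Nonempty → tie h T ∈ T)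
    {h : List (Fin n)} {a : Option (Fin n)} {U : Finset (Fin n)} {j : Fin n}
    (hj : nearest d tie h a U = some j) : j ∈ U ∧ ∀ k ∈ U, d a j ≤ d a k := by
  unfold nearest at hj
  split_ifs at hj with hU
  obtain ⟨m, hm, hmin⟩ := U.exists_min_image (d a) hU
  have hmem := htie h {j ∈ U | ∀ k ∈ U, d a j ≤ d a k} ⟨m, Finset.mem_filter.2 ⟨hm, hmin⟩⟩
  rw [Option.some.inj hj] at hmem
  exact Finset.mem_filter.1 hmem

theorem eq_empty_of_nearest_eq_none {h : List (Fin n)} {a : Option (Fin n)} {U : Finset (Fin n)}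
    (hnone : nearest d tie h a U = none) : U = ∅ := by
  unfold nearest at hnone
  split_ifs at hnone with hU
  exact Finset.not_nonempty_iff_eq_empty.1 hU

/-- The edges between rewards along which depth first search with threshold `θ` moves. -/
def ShortEdge (d : Option (Fin n) → Fin n → ℕ) (θ : ℝ) (i j : Fin n) : Prop :=
  (d (some i) j : ℝ) < θ

theorem DFSState.dfs_succ (htie : ∀ h T, T.Nonempty → tie h T ∈ T) {θ : ℝ} {s : Fin n}
    {stack walk : List (Fin n)} (h : DFSState (ShortEdge d θ) s stack walk) (k : ℕ) :
    (∃ stack' v, DFSState (ShortEdge d θ) s stack' (walk ++ [v]) ∧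
      dfs d tie θ (k + 1) stack walk = dfs d tie θ k stack' (walk ++ [v])) ∨
    (dfs d tie θ (k + 1) stack walk = walk ∧ ∀ j, ShortEdge d θ s j → j ∈ walk) := by
  obtain ⟨u, stack, rfl⟩ := List.exists_cons_of_ne_nil h.stack_ne_nil
  cases hnext : nearest d tie walk (some u)
      (Finset.univ.filter fun j => j ∉ walk ∧ (d (some u) j : ℝ) < θ) with
  | some j =>
    have hj := (mem_and_edge_le_of_nearest_eq_some htie hnext).1
    simp only [Finset.mem_filter, Finset.mem_univ, true_and] at hj
    exact .inl ⟨_, _, h.descend hj.1 hj.2, by simp only [dfs, hnext]⟩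
  | none =>
    cases stack with
    | cons p stack => exact .inl ⟨_, _, h.backtrack, by simp only [dfs, hnext]⟩
    | nil =>
      obtain rfl : u = s := by simpa using h.getLast?_stack
      refine .inr ⟨by simp only [dfs, hnext], fun j hj => ?_⟩
      by_contra hjw
      exact Finset.eq_empty_iff_forall_notMem.1 (eq_empty_of_nearest_eq_none hnext) j
        (by simpa using ⟨hjw, hj⟩)

theorem DFSState.exists_dfs (htie : ∀ h T, T.Nonempty → tie h T ∈ T) {θ : ℝ} {s : Fin n}
    {stack walk : List (Fin n)} (h : DFSState (ShortEdge d θ) s stack walk) (k : ℕ) :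
    ∃ stack', DFSState (ShortEdge d θ) s stack' (dfs d tie θ k stack walk) := by
  induction k generalizing stack walk with
  | zero => exact ⟨stack, by simpa only [dfs] using h⟩
  | succ k ih =>
    rcases h.dfs_succ htie k with ⟨stack', v, h', heq⟩ | ⟨heq, -⟩
    · exact heq ▸ ih h'
    · exact ⟨stack, heq.symm ▸ h⟩

theorem DFSState.mem_dfs_of_shortEdge (htie : ∀ h T, T.Nonempty → tie h T ∈ T) {θ : ℝ}
    {s : Fin n} {stack walk : List (Fin n)} (h : DFSState (ShortEdge d θ) s stack walk) {k : ℕ}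
    (hk : 2 * n ≤ walk.length + k) {j : Fin n} (hj : ShortEdge d θ s j) :
    j ∈ dfs d tie θ k stack walk := by
  induction k generalizing stack walk with
  | zero =>
    have hcard : walk.toFinset.card ≤ n := by simpa using walk.toFinset.card_le_univ
    have := h.length_walk_add_length_stack
    have := List.length_pos_iff.2 h.stack_ne_nil
    omega
  | succ k ih =>
    rcases h.dfs_succ htie k with ⟨stack', v, h', heq⟩ | ⟨heq, hall⟩
    · exact heq ▸ ih h' (by simp only [List.length_append, List.length_singleton]; omega)
    · exact heq.symm ▸ hall j hj

theorem walkLength_le_of_isChain {θ : ℝ} {a : Fin n} {l : List (Fin n)}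
    (h : (a :: l).IsChain (ShortEdge d θ)) : (walkLength d (some a) l : ℝ) ≤ l.length * θ := by
  induction l generalizing a with
  | nil => simp [walkLength]
  | cons b l ih =>
    obtain ⟨hab, hl⟩ := List.isChain_cons_cons.1 h
    have hab : (d (some a) b : ℝ) < θ := hab
    have := ih hl
    simp only [walkLength, List.length_cons]
    push_cast
    linarith

theorem prefix_nn (d : Option (Fin n) → Fin n → ℕ)
    (tie : List (Fin n) → Finset (Fin n) → Fin n) (k : ℕ) (h : List (Fin n)) :
    h <+: nn d tie k h := by
  induction k generalizing h with
  | zero => exact List.prefix_rfl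
  | succ k ih =>
    unfold nn
    split
    · exact List.prefix_rfl
    · exact (List.prefix_append _ _).trans (ih _)

theorem exists_prefix_rdfsWalk (htie : ∀ h T, T.Nonempty → tie h T ∈ T)
    (hsymm : ∀ i j, d (some i) j = d (some j) i) {θ : ℝ} (hθ : 0 ≤ θ) (s : Fin n) (m : ℕ)
    {B : Finset (Fin n)} (hB : ∀ j ∈ B, j ≠ s → ShortEdge d θ s j) :
    ∃ p, p <+: rdfsWalk d tie θ s ∧ (walkLength d none p : ℝ) ≤ d none s + 2 * m * θ ∧
      min m B.card ≤ p.toFinset.card := by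
  set w := dfs d tie θ (2 * n) [s] [s]
  obtain ⟨stack, hw⟩ : ∃ stack, DFSState (ShortEdge d θ) s stack w :=
    DFSState.root.exists_dfs htie _
  obtain ⟨l, hl⟩ := hw.exists_walk_eq_cons
  have hpw : w.take (2 * m + 1) <+: w := List.take_prefix _ _
  refine ⟨w.take (2 * m + 1), hpw.trans (prefix_nn _ _ _ _), ?_, ?_⟩
  · have hchain : (s :: l.take (2 * m)).IsChain (ShortEdge d θ) := by
      simpa only [hl, List.take_succ_cons] using
        (hw.isChain_walk fun a b hab => by rwa [ShortEdge, hsymm]).prefix hpw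
    have hlen : ((l.take (2 * m)).length : ℝ) ≤ 2 * m := by
      exact_mod_cast List.length_take_le _ _
    simp only [hl, List.take_succ_cons, walkLength]
    push_cast
    gcongr
    exact (walkLength_le_of_isChain hchain).trans (mul_le_mul_of_nonneg_right hlen hθ)
  · rcases le_total (2 * m + 1) w.length with hlong | hshort
    · have := hw.length_lt_two_mul_card_of_prefix hpw (by simp [hl])
      rw [List.length_take_of_le hlong] at this
      omega
    · rw [List.take_of_length_le hshort]
      refine (min_le_right _ _).trans (Finset.card_le_card fun j hj => List.mem_toFinset.2 ?_)
      by_cases hjs : j = s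
      · simp [hl, hjs]
      · exact DFSState.root.mem_dfs_of_shortEdge htie (by simp) (hB j hj hjs)

end DepthFirstSearch

end RDTSP

namespace RDTSP

section Returns

variable {n : ℕ} {d : Option (Fin n) → Fin n → ℕ}
  {tie : List (Fin n) → Finset (Fin n) → Fin n} {γ : ℝ}

theorem discountedReturn_nonneg (hγ : 0 ≤ γ) (d : Option (Fin n) → Fin n → ℕ)
    (w : List (Fin n)) : 0 ≤ discountedReturn γ d w :=
  Finset.sum_nonneg fun j _ => by split_ifs <;> positivity

theorem card_mul_rpow_le_discountedReturn (hγ : 0 < γ) (hγ₁ : γ ≤ 1)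
    (d : Option (Fin n) → Fin n → ℕ) {p w : List (Fin n)} (hp : p <+: w) {D : ℝ}
    (hD : (walkLength d none p : ℝ) ≤ D) :
    (p.toFinset.card : ℝ) * γ ^ D ≤ discountedReturn γ d w := by
  calc (p.toFinset.card : ℝ) * γ ^ D
      = ∑ _j ∈ p.toFinset, γ ^ D := by simp
    _ ≤ ∑ j ∈ p.toFinset, if j ∈ w then γ ^ arrival d w j else 0 := by
        refine Finset.sum_le_sum fun j hj => ?_
        have hjp : j ∈ p := List.mem_toFinset.1 hj
        rw [if_pos (hp.subset hjp), ← Real.rpow_natCast]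
        refine Real.rpow_le_rpow_of_exponent_ge hγ hγ₁ (le_trans ?_ hD)
        exact_mod_cast arrival_le_of_prefix d hp hjp
    _ ≤ discountedReturn γ d w :=
        Finset.sum_le_sum_of_subset_of_nonneg (Finset.subset_univ _)
          fun j _ _ => by split_ifs <;> positivity

theorem pow_edge_le_discountedReturn_nnWalk (hγ : 0 < γ) (hγ₁ : γ ≤ 1)
    (htie : ∀ h T, T.Nonempty → tie h T ∈ T) (i : Fin n) :
    γ ^ d none i ≤ discountedReturn γ d (nnWalk d tie) := by
  obtain ⟨m, rfl⟩ : ∃ m, n = m + 1 := Nat.exists_eq_add_one.2 i.pos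
  unfold nnWalk nn
  split
  · next hnone =>
    exact absurd (eq_empty_of_nearest_eq_none hnone) (Finset.ne_empty_of_mem (a := i) (by simp))
  · next j hj =>
    have hji : d none j ≤ d none i := (mem_and_edge_le_of_nearest_eq_some htie hj).2 i (by simp)
    simpa using card_mul_rpow_le_discountedReturn hγ hγ₁ d (prefix_nn d tie m [j])
      (D := d none i) (by simpa [walkLength] using hji)

theorem half_mul_discountedReturn_nnWalk_le_nnRDFS (hγ : 0 ≤ γ)
    (d : Option (Fin n) → Fin n → ℕ) (tie : List (Fin n) → Finset (Fin n) → Fin n) :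
    1 / 2 * discountedReturn γ d (nnWalk d tie) ≤ nnRDFS γ d tie := by
  refine le_add_of_nonneg_right (mul_nonneg (by norm_num) (mul_nonneg (by positivity) ?_))
  exact Finset.sum_nonneg fun s _ => mul_nonneg (by positivity)
    (Finset.sum_nonneg fun i _ => discountedReturn_nonneg hγ d _)

theorem nnRDFS_nonneg (hγ : 0 ≤ γ) (d : Option (Fin n) → Fin n → ℕ)
    (tie : List (Fin n) → Finset (Fin n) → Fin n) : 0 ≤ nnRDFS γ d tie :=
  (mul_nonneg (by norm_num) (discountedReturn_nonneg hγ d _)).trans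
    (half_mul_discountedReturn_nnWalk_le_nnRDFS hγ d tie)

theorem pow_edge_le_two_mul_nnRDFS (hγ : 0 < γ) (hγ₁ : γ ≤ 1)
    (htie : ∀ h T, T.Nonempty → tie h T ∈ T) (i : Fin n) :
    γ ^ d none i ≤ 2 * nnRDFS γ d tie := by
  linarith [pow_edge_le_discountedReturn_nnWalk (d := d) hγ hγ₁ htie i,
    half_mul_discountedReturn_nnWalk_le_nnRDFS hγ.le d tie]

theorem sum_discountedReturn_rdfsWalk_le_nnRDFS (hγ : 0 ≤ γ) {i : ℕ}
    (hi : i ∈ Finset.Icc 1 (Nat.log 2 n)) (S : Finset (Fin n)) :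
    ∑ s ∈ S, discountedReturn γ d (rdfsWalk d tie (threshold n γ i) s) ≤
      2 * (n * Nat.log 2 n * nnRDFS γ d tie) := by
  have hret (w : List (Fin n)) : 0 ≤ discountedReturn γ d w := discountedReturn_nonneg hγ d w
  have hlog : 0 < Nat.log 2 n := Nat.lt_of_lt_of_le Nat.one_pos
    ((Finset.mem_Icc.1 hi).1.trans (Finset.mem_Icc.1 hi).2)
  have hn : 0 < n := Nat.pos_of_ne_zero fun hn => by simp [hn] at hlog
  set V : ℕ → Fin n → ℝ := fun i s => discountedReturn γ d (rdfsWalk d tie (threshold n γ i) s)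
  calc ∑ s ∈ S, V i s
      ≤ ∑ s, V i s := Finset.sum_le_sum_of_subset_of_nonneg (Finset.subset_univ _)
        fun _ _ _ => hret _
    _ ≤ ∑ s, ∑ i ∈ Finset.Icc 1 (Nat.log 2 n), V i s :=
        Finset.sum_le_sum fun s _ =>
          Finset.single_le_sum (f := fun i => V i s) (fun _ _ => hret _) hi
    _ = 2 * (n * Nat.log 2 n * (1 / 2 * (1 / n * ∑ s, 1 / Nat.log 2 n *
          ∑ i ∈ Finset.Icc 1 (Nat.log 2 n), V i s))) := by
        rw [← Finset.mul_sum]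
        field_simp
    _ ≤ 2 * (n * Nat.log 2 n * nnRDFS γ d tie) := by
        gcongr
        exact le_add_of_nonneg_left (mul_nonneg (by norm_num) (hret _))

end Returns

section HalfLife

/-- The time `log_{1/γ} 2` in which the discount decreases by a factor of two. It is the numerator
of `threshold`. -/
noncomputable def halfLife (γ : ℝ) : ℝ :=
  Real.logb (1 / γ) 2

variable {γ : ℝ}

theorem halfLife_pos (hγ : 0 < γ) (hγ₁ : γ < 1) : 0 < halfLife γ :=
  Real.logb_pos (one_lt_one_div hγ hγ₁) one_lt_two

theorem rpow_mul_halfLife (hγ : 0 < γ) (hγ₁ : γ < 1) (y : ℝ) :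
    γ ^ (y * halfLife γ) = (1 / 2 : ℝ) ^ y := by
  have h : (1 / γ) ^ halfLife γ = 2 :=
    Real.rpow_logb (by positivity) (one_lt_one_div hγ hγ₁).ne' two_pos
  rw [one_div, Real.inv_rpow hγ.le, inv_eq_iff_eq_inv] at h
  rw [mul_comm, Real.rpow_mul hγ.le, h, one_div]

end HalfLife

section Slot

theorem two_mul_card_sub_le_sum_min_card_fiber {ι κ : Type*} [DecidableEq κ] {S : Finset ι}
    {cells : Finset κ} {f : ι → κ} (hf : ∀ s ∈ S, f s ∈ cells) {μ : ℝ} {m : ℕ}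
    (hm : 2 * μ ≤ m) :
    2 * μ * S.card - μ ^ 2 * cells.card ≤
      ∑ s ∈ S, ((min m (S.filter fun j => f j = f s).card : ℕ) : ℝ) := by
  have tangent (c : ℕ) : 2 * μ * c - μ ^ 2 ≤ c * ((min m c : ℕ) : ℝ) := by
    rcases le_total m c with h | h
    · rw [min_eq_left h]
      nlinarith [mul_le_mul_of_nonneg_left hm (Nat.cast_nonneg (α := ℝ) c), sq_nonneg μ]
    · rw [min_eq_right h]
      nlinarith [sq_nonneg ((c : ℝ) - μ)]
  calc 2 * μ * S.card - μ ^ 2 * cells.card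
      = ∑ b ∈ cells, (2 * μ * (S.filter fun j => f j = b).card - μ ^ 2) := by
        rw [Finset.card_eq_sum_card_fiberwise hf, Finset.sum_sub_distrib, ← Finset.mul_sum,
          Finset.sum_const, nsmul_eq_mul, Nat.cast_sum, mul_comm (μ ^ 2)]
    _ ≤ ∑ b ∈ cells, ∑ s ∈ S with f s = b,
          ((min m (S.filter fun j => f j = f s).card : ℕ) : ℝ) := by
        refine Finset.sum_le_sum fun b _ => (tangent _).trans_eq ?_
        rw [← nsmul_eq_mul, ← Finset.sum_const]
        exact Finset.sum_congr rfl fun s hs => by rw [(Finset.mem_filter.1 hs).2]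
    _ = _ := Finset.sum_fiberwise_of_maps_to hf _

theorem exists_mem_Icc_log_div_two_pow {n k : ℕ} (hn : 2 ≤ n) (hk : 0 < k) (hkn : k ≤ n) :
    ∃ i ∈ Finset.Icc 1 (Nat.log 2 n),
      (k : ℝ) / 2 ≤ (n : ℝ) / 2 ^ i ∧ (n : ℝ) / 2 ^ i ≤ 2 * k := by
  set i := Nat.log 2 (n / k)
  have hle : (2 : ℝ) ^ i * k ≤ n := by
    exact_mod_cast (Nat.le_div_iff_mul_le hk).1
      (Nat.pow_log_le_self 2 (Nat.div_pos hkn hk).ne')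
  have hlt : (n : ℝ) < 2 ^ (i + 1) * k := by
    exact_mod_cast (Nat.div_lt_iff_lt_mul hk).1 (Nat.lt_pow_succ_log_self one_lt_two (n / k))
  rw [pow_succ] at hlt
  rcases Nat.eq_zero_or_pos i with hi | hi
  · rw [hi, pow_zero] at hle hlt
    refine ⟨1, Finset.mem_Icc.2 ⟨le_rfl, Nat.log_pos one_lt_two hn⟩, ?_, ?_⟩ <;>
      rw [pow_one] <;> linarith
  · refine ⟨i, Finset.mem_Icc.2 ⟨hi, Nat.log_mono_right (Nat.div_le_self n k)⟩, ?_, ?_⟩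
    · rw [le_div_iff₀ (by positivity)]
      nlinarith
    · rw [div_le_iff₀ (by positivity)]
      linarith

theorem abs_sub_lt_of_floor_div_eq {θ a b : ℝ} (hθ : 0 < θ) (ha : 0 ≤ a) (hb : 0 ≤ b)
    (h : ⌊a / θ⌋₊ = ⌊b / θ⌋₊) : |a - b| < θ := by
  have hlt : |a / θ - b / θ| < 1 := Int.abs_sub_lt_one_of_floor_eq_floor <| by
    rw [← Int.natCast_floor_eq_floor (by positivity), ← Int.natCast_floor_eq_floor (by positivity),
      h]
  rwa [← sub_div, abs_div, abs_of_pos hθ, div_lt_one hθ] at hlt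

theorem mul_sqrt_div_eight_le {k r : ℝ} (hr : 2 / 3 ≤ r) (hkr : k ≤ 2 * r ^ 2)
    (hrk : r ^ 2 ≤ 2 * k) : k * √k / 8 ≤ 2 * (r / 5) * k - (r / 5) ^ 2 * (r + 1) := by
  have hk : 0 ≤ k := by nlinarith
  have hsqrt : √k ≤ 8 / 5 * r := Real.sqrt_le_iff.2 ⟨by linarith, by rw [mul_pow]; linarith⟩
  calc k * √k / 8 ≤ k * (8 / 5 * r) / 8 := by gcongr
    _ ≤ 2 * (r / 5) * k - (r / 5) ^ 2 * (5 / 2 * r) := by nlinarith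
    _ ≤ 2 * (r / 5) * k - (r / 5) ^ 2 * (r + 1) := by gcongr; linarith

variable {n : ℕ} {d : Option (Fin n) → Fin n → ℕ}
  {tie : List (Fin n) → Finset (Fin n) → Fin n} {γ : ℝ} {t : Fin n → ℕ} {S : Finset (Fin n)}
  {T : ℝ}

/-- Rewards of `S` visited in the same time cell of length `θ` are within `θ` of each other, so
depth first search from one of them finds the others. -/
theorem mul_rpow_le_sum_discountedReturn_rdfsWalk (hγ : 0 < γ) (hγ₁ : γ ≤ 1)
    (htie : ∀ h T, T.Nonempty → tie h T ∈ T) (hsymm : ∀ i j, d (some i) j = d (some j) i)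
    (ht : FeasibleTimes d t) {ℓ θ : ℝ} (hθ : 0 < θ) (hlow : ∀ j ∈ S, T ≤ t j)
    (hup : ∀ j ∈ S, t j ≤ T + ℓ) {μ : ℝ} {m : ℕ} (hm : 2 * μ ≤ m) :
    (2 * μ * S.card - μ ^ 2 * (⌊ℓ / θ⌋₊ + 1)) * γ ^ (T + ℓ + 2 * m * θ) ≤
      ∑ s ∈ S, discountedReturn γ d (rdfsWalk d tie θ s) := by
  set cell : Fin n → ℕ := fun j => ⌊(t j - T) / θ⌋₊
  have hcell : ∀ s ∈ S, cell s ∈ Finset.range (⌊ℓ / θ⌋₊ + 1) := fun s hs =>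
    Finset.mem_range_succ_iff.2 (Nat.floor_le_floor (by gcongr; linarith [hup s hs]))
  have hreturn : ∀ s ∈ S, ((min m (S.filter fun j => cell j = cell s).card : ℕ) : ℝ) *
      γ ^ (T + ℓ + 2 * m * θ) ≤ discountedReturn γ d (rdfsWalk d tie θ s) := by
    intro s hs
    have hclose : ∀ j ∈ S.filter fun j => cell j = cell s, j ≠ s → ShortEdge d θ s j := by
      intro j hj hjs
      obtain ⟨hjS, hjcell⟩ := Finset.mem_filter.1 hj
      have habs := abs_sub_lt_of_floor_div_eq hθ (sub_nonneg.2 (hlow s hs))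
        (sub_nonneg.2 (hlow j hjS)) hjcell.symm
      rw [sub_sub_sub_cancel_right] at habs
      exact (ht.edge_some_le s j hjs.symm).trans_lt habs
    obtain ⟨p, hp, hlen, hcard⟩ := exists_prefix_rdfsWalk htie hsymm hθ.le s m hclose
    have hstart : (d none s : ℝ) ≤ t s := by exact_mod_cast ht.edge_none_le s
    refine le_trans ?_ (card_mul_rpow_le_discountedReturn hγ hγ₁ d hp
      (D := T + ℓ + 2 * m * θ) (by linarith [hup s hs]))
    gcongr
  have hcount := two_mul_card_sub_le_sum_min_card_fiber hcell hm
  rw [Finset.card_range, Nat.cast_succ] at hcount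
  refine (mul_le_mul_of_nonneg_right hcount (Real.rpow_nonneg hγ.le _)).trans ?_
  rw [Finset.sum_mul]
  exact Finset.sum_le_sum hreturn

/-- With `r = √q`, the slot has at most `r + 1` cells of length `halfLife γ / r`, and a search for
`⌈r⌉` rewards takes time at most `5 * halfLife γ`. -/
theorem card_mul_sqrt_le_sum_discountedReturn_rdfsWalk (hγ : 0 < γ) (hγ₁ : γ < 1)
    (htie : ∀ h T, T.Nonempty → tie h T ∈ T) (hsymm : ∀ i j, d (some i) j = d (some j) i)
    (ht : FeasibleTimes d t) (hS : S.Nonempty) (hlow : ∀ j ∈ S, T ≤ t j)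
    (hup : ∀ j ∈ S, t j ≤ T + halfLife γ) {q : ℝ} (hq₁ : (S.card : ℝ) / 2 ≤ q)
    (hq₂ : q ≤ 2 * S.card) :
    γ ^ T * (S.card * √S.card) ≤
      512 * ∑ s ∈ S, discountedReturn γ d (rdfsWalk d tie (halfLife γ / √q) s) := by
  set k : ℝ := (S.card : ℝ)
  set r := √q
  have hx := halfLife_pos hγ hγ₁
  have hk : 1 ≤ k := Nat.one_le_cast.2 hS.card_pos
  have hrq : r ^ 2 = q := Real.sq_sqrt (by linarith)
  have hr : 2 / 3 ≤ r := Real.le_sqrt_of_sq_le (by norm_num; linarith)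
  have hceil : (⌈r⌉₊ : ℝ) ≤ r + 1 := (Nat.ceil_lt_add_one (by linarith)).le
  have hcells : (⌊halfLife γ / (halfLife γ / r)⌋₊ : ℝ) ≤ r := by
    rw [div_div_cancel₀ hx.ne']
    exact Nat.floor_le (by linarith)
  have htime : T + halfLife γ + 2 * ⌈r⌉₊ * (halfLife γ / r) ≤ T + 6 * halfLife γ := by
    have : 2 * ⌈r⌉₊ * (halfLife γ / r) ≤ 5 * halfLife γ := by
      rw [mul_div_assoc', div_le_iff₀ (by linarith)]
      nlinarith
    linarith
  have hcount : k * √k / 8 ≤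
      2 * (r / 5) * k - (r / 5) ^ 2 * (⌊halfLife γ / (halfLife γ / r)⌋₊ + 1) :=
    (mul_sqrt_div_eight_le hr (by linarith) (by linarith)).trans (by gcongr)
  have hsum := mul_rpow_le_sum_discountedReturn_rdfsWalk hγ hγ₁.le htie hsymm ht
    (θ := halfLife γ / r) (div_pos hx (by linarith)) hlow hup (μ := r / 5) (m := ⌈r⌉₊)
    (by linarith [Nat.le_ceil r])
  calc γ ^ T * (k * √k) = 512 * (k * √k / 8 * γ ^ (T + 6 * halfLife γ)) := by
        rw [Real.rpow_add hγ, rpow_mul_halfLife hγ hγ₁]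
        norm_num
        ring
    _ ≤ _ := by
        refine mul_le_mul_of_nonneg_left (le_trans ?_ hsum) (by norm_num)
        exact mul_le_mul hcount (Real.rpow_le_rpow_of_exponent_ge hγ hγ₁.le htime)
          (by positivity) (le_trans (by positivity) hcount)

theorem card_mul_sqrt_le_nnRDFS (hn : 2 ≤ n) (hγ : 0 < γ) (hγ₁ : γ < 1)
    (htie : ∀ h T, T.Nonempty → tie h T ∈ T) (hsymm : ∀ i j, d (some i) j = d (some j) i)
    (ht : FeasibleTimes d t) (hlow : ∀ j ∈ S, T ≤ t j)
    (hup : ∀ j ∈ S, t j ≤ T + halfLife γ) :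
    γ ^ T * (S.card * √S.card) ≤ 1024 * (n * Nat.log 2 n * nnRDFS γ d tie) := by
  rcases S.eq_empty_or_nonempty with rfl | hS
  · have := nnRDFS_nonneg hγ.le d tie
    simp only [Finset.card_empty, Nat.cast_zero, zero_mul, mul_zero]
    positivity
  · obtain ⟨i, hi, hq₁, hq₂⟩ :=
      exists_mem_Icc_log_div_two_pow hn hS.card_pos (by simpa using S.card_le_univ)
    have hslot := card_mul_sqrt_le_sum_discountedReturn_rdfsWalk hγ hγ₁ htie hsymm ht hS hlow hup
      hq₁ hq₂
    have hmean := sum_discountedReturn_rdfsWalk_le_nnRDFS (d := d) (tie := tie) hγ.le hi S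
    rw [threshold, ← halfLife] at hmean
    linarith

end Slot

section Optimum

theorem sum_pow_pow_three_le_of_card_mul_sqrt_le {ι : Type*} {γ τ Q : ℝ} (hγ : 0 < γ)
    (hγ₁ : γ ≤ 1) {t : ι → ℕ} {S : Finset ι} (hτ : ∀ j ∈ S, τ ≤ t j)
    (hQ : γ ^ τ * (S.card * √S.card) ≤ Q) : (∑ j ∈ S, γ ^ t j) ^ 3 ≤ γ ^ τ * Q ^ 2 := by
  have hsum : ∑ j ∈ S, γ ^ t j ≤ S.card * γ ^ τ := by
    rw [← nsmul_eq_mul]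
    refine Finset.sum_le_card_nsmul _ _ _ fun j hj => ?_
    rw [← Real.rpow_natCast]
    exact Real.rpow_le_rpow_of_exponent_ge hγ hγ₁ (hτ j hj)
  calc (∑ j ∈ S, γ ^ t j) ^ 3 ≤ (S.card * γ ^ τ) ^ 3 := by gcongr
    _ = γ ^ τ * (γ ^ τ * (S.card * √S.card)) ^ 2 := by
        rw [mul_pow (γ ^ τ), mul_pow _ √_, Real.sq_sqrt (Nat.cast_nonneg _)]
        ring
    _ ≤ γ ^ τ * Q ^ 2 := by gcongr

/-- The cube roots of the bounds form a geometric series; `4 / 5` is a rational upper bound of its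
ratio, the cube root of `1 / 2`. -/
theorem sum_pow_three_le_of_pow_three_le_geometric {a : ℕ → ℝ} {A : ℝ} (hA : 0 ≤ A)
    (ha : ∀ l, a l ^ 3 ≤ A * (1 / 2) ^ l) {s : Finset ℕ} (hs : ∀ l ∈ s, 0 ≤ a l) :
    (∑ l ∈ s, a l) ^ 3 ≤ 125 * A := by
  obtain ⟨Z, hZ, hZ₃⟩ : ∃ Z : ℝ, 0 ≤ Z ∧ Z ^ 3 = A :=
    ⟨A ^ (3⁻¹ : ℝ), by positivity,
      by exact_mod_cast Real.rpow_inv_natCast_pow (n := 3) hA three_ne_zero⟩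
  have hterm (l : ℕ) : a l ≤ Z * (4 / 5) ^ l := by
    refine le_of_pow_le_pow_left₀ three_ne_zero (by positivity) ?_
    calc a l ^ 3 ≤ Z ^ 3 * (1 / 2) ^ l := hZ₃ ▸ ha l
      _ ≤ Z ^ 3 * ((4 / 5) ^ 3) ^ l := by gcongr; norm_num
      _ = (Z * (4 / 5) ^ l) ^ 3 := by rw [mul_pow, pow_right_comm]
  have hgeom : ∑ l ∈ s, (4 / 5 : ℝ) ^ l ≤ 5 :=
    (Summable.sum_le_tsum s (fun _ _ => by positivity)
      (summable_geometric_of_lt_one (by norm_num) (by norm_num))).trans_eq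
      (by rw [tsum_geometric_of_lt_one] <;> norm_num)
  calc (∑ l ∈ s, a l) ^ 3 ≤ (∑ l ∈ s, Z * (4 / 5) ^ l) ^ 3 :=
        pow_le_pow_left₀ (Finset.sum_nonneg hs) (Finset.sum_le_sum fun l _ => hterm l) 3
    _ ≤ (Z * 5) ^ 3 := by rw [← Finset.mul_sum]; gcongr
    _ = 125 * A := by rw [mul_pow, hZ₃]; ring

theorem sum_pow_pow_three_le {ι : Type*} [Fintype ι] {γ T Q : ℝ} (hγ : 0 < γ) (hγ₁ : γ < 1)
    {t : ι → ℕ} (hT : ∀ j, T ≤ t j)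
    (hQ : ∀ (τ : ℝ) (S : Finset ι), (∀ j ∈ S, τ ≤ t j) → (∀ j ∈ S, t j ≤ τ + halfLife γ) →
      γ ^ τ * (S.card * √S.card) ≤ Q) :
    (∑ j, γ ^ t j) ^ 3 ≤ 125 * (γ ^ T * Q ^ 2) := by
  have hx := halfLife_pos hγ hγ₁
  set slot : ι → ℕ := fun j => ⌊(t j - T) / halfLife γ⌋₊
  have hlow (j : ι) : T + slot j * halfLife γ ≤ t j := by
    have := (le_div_iff₀ hx).1 (Nat.floor_le (div_nonneg (sub_nonneg.2 (hT j)) hx.le))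
    linarith
  have hup (j : ι) : t j ≤ T + slot j * halfLife γ + halfLife γ := by
    have := (div_lt_iff₀ hx).1 (Nat.lt_floor_add_one ((t j - T) / halfLife γ))
    linarith
  have hslot (l : ℕ) : (∑ j with slot j = l, γ ^ t j) ^ 3 ≤ γ ^ T * Q ^ 2 * (1 / 2) ^ l := by
    have hlow' : ∀ j ∈ Finset.univ.filter fun j => slot j = l, T + l * halfLife γ ≤ t j :=
      fun j hj => (Finset.mem_filter.1 hj).2 ▸ hlow j
    refine (sum_pow_pow_three_le_of_card_mul_sqrt_le hγ hγ₁.le hlow' (hQ _ _ hlow'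
      fun j hj => (Finset.mem_filter.1 hj).2 ▸ hup j)).trans_eq ?_
    rw [Real.rpow_add hγ, rpow_mul_halfLife hγ hγ₁, Real.rpow_natCast, mul_right_comm]
  rw [← Finset.sum_fiberwise_of_maps_to (t := Finset.univ.image slot)
    fun j hj => Finset.mem_image_of_mem slot hj]
  exact sum_pow_three_le_of_pow_three_le_geometric (by positivity) hslot
    fun l _ => Finset.sum_nonneg fun j _ => by positivity

variable {n : ℕ} {d : Option (Fin n) → Fin n → ℕ}
  {tie : List (Fin n) → Finset (Fin n) → Fin n} {γ : ℝ}

theorem opt_nonneg (hγ : 0 ≤ γ) (d : Option (Fin n) → Fin n → ℕ) : 0 ≤ opt γ d :=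
  (discountedReturn_nonneg hγ d _).trans
    (Finset.le_sup' (fun σ : Equiv.Perm (Fin n) => discountedReturn γ d (List.ofFn fun i => σ i))
      (Finset.mem_univ 1))

theorem natLog_two_le_two_mul_log (n : ℕ) : (Nat.log 2 n : ℝ) ≤ 2 * Real.log n := by
  have hlog : 0 ≤ Real.log n := Real.log_natCast_nonneg n
  have htwo := Real.log_two_gt_d9
  calc (Nat.log 2 n : ℝ) ≤ Real.log n / Real.log 2 := Real.natLog_le_logb n 2
    _ ≤ 2 * Real.log n := by
        rw [div_le_iff₀ (by linarith)]
        nlinarith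

theorem opt_pow_three_le (hn : 2 ≤ n) (hγ : 0 < γ) (hγ₁ : γ < 1)
    (htri : ∀ a j k, d a k ≤ d a j + d (some j) k)
    (hsymm : ∀ i j, d (some i) j = d (some j) i) (htie : ∀ h T, T.Nonempty → tie h T ∈ T)
    {T : ℕ} (hT : ∀ j, T ≤ d none j) :
    opt γ d ^ 3 ≤ 125 * (γ ^ T * (2048 * (n * Real.log n * nnRDFS γ d tie)) ^ 2) := by
  obtain ⟨t, ht, hopt⟩ := exists_feasibleTimes_opt_eq γ htri hsymm
  have hR := nnRDFS_nonneg hγ.le d tie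
  have hlog : 1024 * (n * Nat.log 2 n * nnRDFS γ d tie) ≤
      2048 * (n * Real.log n * nnRDFS γ d tie) := by
    calc 1024 * (n * Nat.log 2 n * nnRDFS γ d tie)
        ≤ 1024 * (n * (2 * Real.log n) * nnRDFS γ d tie) := by
          gcongr
          exact natLog_two_le_two_mul_log n
      _ = _ := by ring
  rw [hopt, ← Real.rpow_natCast γ T]
  exact sum_pow_pow_three_le hγ hγ₁ (fun j => Nat.cast_le.2 ((hT j).trans (ht.edge_none_le j)))
    fun τ S hlow hup =>
      (card_mul_sqrt_le_nnRDFS hn hγ hγ₁ htie hsymm ht hlow hup).trans hlog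

theorem opt_rpow_three_halves_le (hn : 2 ≤ n) (hγ : 0 < γ) (hγ₁ : γ < 1)
    (htri : ∀ a j k, d a k ≤ d a j + d (some j) k)
    (hsymm : ∀ i j, d (some i) j = d (some j) i) (htie : ∀ h T, T.Nonempty → tie h T ∈ T) :
    opt γ d ^ (3 / 2 : ℝ) ≤ 24576 * (n * Real.log n * nnRDFS γ d tie) := by
  have hR := nnRDFS_nonneg hγ.le d tie
  have hopt := opt_nonneg hγ.le d
  have hcube := opt_pow_three_le hn hγ hγ₁ htri hsymm htie (T := 0) fun j => Nat.zero_le _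
  refine le_of_sq_le_sq ?_ (by positivity)
  calc (opt γ d ^ (3 / 2 : ℝ)) ^ 2 = opt γ d ^ 3 := by
        rw [← Real.rpow_mul_natCast hopt, ← Real.rpow_natCast]
        norm_num
    _ ≤ 125 * 2048 ^ 2 * (n * Real.log n * nnRDFS γ d tie) ^ 2 := by
        linarith
    _ ≤ (24576 * (n * Real.log n * nnRDFS γ d tie)) ^ 2 := by
        rw [mul_pow 24576]
        gcongr
        norm_num

theorem opt_le_mul_nnRDFS (hn : 2 ≤ n) (hγ : 0 < γ) (hγ₁ : γ < 1)
    (htri : ∀ a j k, d a k ≤ d a j + d (some j) k)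
    (hsymm : ∀ i j, d (some i) j = d (some j) i) (htie : ∀ h T, T.Nonempty → tie h T ∈ T) :
    opt γ d ≤ 24576 * ((n * Real.log n) ^ (2 / 3 : ℝ) * nnRDFS γ d tie) := by
  have hR := nnRDFS_nonneg hγ.le d tie
  obtain ⟨i, -, hi⟩ := Finset.univ.exists_min_image (d none) ⟨⟨0, by omega⟩, Finset.mem_univ _⟩
  have hcube := opt_pow_three_le hn hγ hγ₁ htri hsymm htie fun j => hi j (Finset.mem_univ j)
  refine le_of_pow_le_pow_left₀ three_ne_zero (by positivity) ?_
  calc opt γ d ^ 3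
      ≤ 125 * (2 * nnRDFS γ d tie * (2048 * (n * Real.log n * nnRDFS γ d tie)) ^ 2) := by
        refine hcube.trans ?_
        gcongr
        exact pow_edge_le_two_mul_nnRDFS hγ hγ₁.le htie i
    _ = 125 * 2 * 2048 ^ 2 * ((n * Real.log n) ^ 2 * nnRDFS γ d tie ^ 3) := by ring
    _ ≤ 24576 ^ 3 * ((n * Real.log n) ^ 2 * nnRDFS γ d tie ^ 3) := by
        gcongr
        norm_num
    _ = (24576 * ((n * Real.log n) ^ (2 / 3 : ℝ) * nnRDFS γ d tie)) ^ 3 := by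
        rw [mul_pow 24576, mul_pow (_ ^ (2 / 3 : ℝ)), ← Real.rpow_mul_natCast (by positivity)]
        norm_num

end Optimum

end RDTSP

namespace CollectibleMDP

variable {n : ℕ} {M : CollectibleMDP.{u, v} n}

theorem Reaches.exists_run {s t : M.State} (h : M.Reaches s t) :
    ∃ l : List M.Action, l.length = M.pathLength s t ∧ M.run s l = t := by
  obtain ⟨l, hl⟩ := h
  exact Nat.sInf_mem (s := {k : ℕ | ∃ l : List M.Action, l.length = k ∧ M.run s l = t})
    ⟨_, l, rfl, hl⟩

theorem run_append (s : M.State) (l₁ l₂ : List M.Action) :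
    M.run s (l₁ ++ l₂) = M.run (M.run s l₁) l₂ :=
  List.foldl_append

theorem pathLength_le_add {r s t : M.State} (hrs : M.Reaches r s) (hst : M.Reaches s t) :
    M.pathLength r t ≤ M.pathLength r s + M.pathLength s t := by
  obtain ⟨l₁, hlen₁, hrun₁⟩ := hrs.exists_run
  obtain ⟨l₂, hlen₂, hrun₂⟩ := hst.exists_run
  refine Nat.sInf_le ⟨l₁ ++ l₂, by rw [List.length_append, hlen₁, hlen₂], ?_⟩
  rw [run_append, hrun₁, hrun₂]

theorem Undirected.edge_le_add (hM : M.Undirected) (a : Option (Fin n)) (j k : Fin n) :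
    M.edge a k ≤ M.edge a j + M.edge (some j) k := by
  refine pathLength_le_add ?_ (hM.reaches j k)
  cases a with
  | none => exact hM.reaches_start j
  | some i => exact hM.reaches i j

end CollectibleMDP

section Rates

variable {n : ℕ}

theorem half_le_log_natCast (hn : 2 ≤ n) : 1 / 2 ≤ Real.log n := by
  have hlog : Real.log 2 ≤ Real.log n := Real.log_le_log two_pos (by exact_mod_cast hn)
  linarith [Real.log_two_gt_d9]

theorem rpow_neg_half_div_sq_log_mul_le (hn : 2 ≤ n) {c α V : ℝ} (hc : 0 ≤ c)
    (hα : 0 ≤ α) (hV : α * n ≤ V) :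
    c * (√α / 2) * ((n : ℝ) ^ (-(1 / 2) : ℝ) / Real.log n ^ 2) * V ≤
      c * (V ^ (3 / 2 : ℝ) / (n * Real.log n)) := by
  have hlog := half_le_log_natCast hn
  have hn₀ : (0 : ℝ) < n := by positivity
  have hV₀ : 0 ≤ V := le_trans (by positivity) hV
  have hhalf : (n : ℝ) ^ (-(1 / 2) : ℝ) = √n / n := by
    rw [Real.rpow_neg hn₀.le, ← Real.sqrt_eq_rpow, Real.sqrt_div_self']
    exact (one_div _).symm
  have hpow : V ^ (3 / 2 : ℝ) = √V * V := by
    rw [Real.sqrt_eq_rpow, ← Real.rpow_add_one' hV₀] <;> norm_num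
  calc c * (√α / 2) * ((n : ℝ) ^ (-(1 / 2) : ℝ) / Real.log n ^ 2) * V
      = c * (√(α * n) * V / (n * (2 * Real.log n * Real.log n))) := by
        rw [hhalf, Real.sqrt_mul hα]
        field_simp
    _ ≤ c * (√V * V / (n * Real.log n)) := by
        gcongr
        nlinarith
    _ = c * (V ^ (3 / 2 : ℝ) / (n * Real.log n)) := by rw [hpow]

theorem rpow_neg_two_thirds_div_sq_log_mul_le (hn : 2 ≤ n) {c V : ℝ} (hc : 0 ≤ c)
    (hV : 0 ≤ V) :
    c / 4 * ((n : ℝ) ^ (-(2 / 3) : ℝ) / Real.log n ^ 2) * V ≤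
      c * (V / (n * Real.log n) ^ (2 / 3 : ℝ)) := by
  have hlog := half_le_log_natCast hn
  have hlog₀ : 0 < Real.log n := by linarith
  have hlog_pow : Real.log n ^ (2 / 3 : ℝ) ≤ 4 * Real.log n ^ 2 :=
    calc Real.log n ^ (2 / 3 : ℝ) ≤ (2 * Real.log n) ^ (2 / 3 : ℝ) := by gcongr; linarith
      _ ≤ (2 * Real.log n) ^ (2 : ℝ) :=
        Real.rpow_le_rpow_of_exponent_le (by linarith) (by norm_num)
      _ = 4 * Real.log n ^ 2 := by rw [Real.rpow_two]; ring
  calc c / 4 * ((n : ℝ) ^ (-(2 / 3) : ℝ) / Real.log n ^ 2) * V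
      = c * (V / ((n : ℝ) ^ (2 / 3 : ℝ) * (4 * Real.log n ^ 2))) := by
        rw [Real.rpow_neg (Nat.cast_nonneg n)]
        field_simp
    _ ≤ c * (V / ((n : ℝ) ^ (2 / 3 : ℝ) * Real.log n ^ (2 / 3 : ℝ))) := by gcongr
    _ = c * (V / (n * Real.log n) ^ (2 / 3 : ℝ)) := by
        rw [Real.mul_rpow (Nat.cast_nonneg n) hlog₀.le]

end Rates

theorem mainTheorem1_general :
    ∃ c : ℝ, 0 < c ∧
      ∀ (n : ℕ), 2 ≤ n → ∀ (M : CollectibleMDP.{u, v} n), M.Undirected →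
      ∀ (γ : ℝ), 0 < γ → γ < 1 →
      ∀ (tie : List (Fin n) → Finset (Fin n) → Fin n),
        (∀ h T, T.Nonempty → tie h T ∈ T) →
        c * (M.OPT γ ^ (3 / 2 : ℝ) / (n * Real.log n)) ≤ M.NNRDFS γ tie ∧
        c * (M.OPT γ / (n * Real.log n) ^ (2 / 3 : ℝ)) ≤ M.NNRDFS γ tie := by
  refine ⟨1 / 24576, by norm_num, fun n hn M hM γ hγ hγ₁ tie htie => ?_⟩
  have hpos : 0 < n * Real.log n :=
    mul_pos (by positivity) (by linarith [half_le_log_natCast hn])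
  have hopt_three_halves : M.OPT γ ^ (3 / 2 : ℝ) ≤ 24576 * (n * Real.log n * M.NNRDFS γ tie) :=
    RDTSP.opt_rpow_three_halves_le hn hγ hγ₁ hM.edge_le_add hM.symm htie
  have hopt : M.OPT γ ≤ 24576 * ((n * Real.log n) ^ (2 / 3 : ℝ) * M.NNRDFS γ tie) :=
    RDTSP.opt_le_mul_nnRDFS hn hγ hγ₁ hM.edge_le_add hM.symm htie
  constructor
  · rw [one_div_mul_eq_div, div_div, div_le_iff₀ (by positivity)]
    linarith
  · rw [one_div_mul_eq_div, div_div, div_le_iff₀ (by positivity)]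
    linarith

theorem mainTheorem1 :
    (∀ α : ℝ, 0 < α → ∃ c : ℝ, 0 < c ∧
      ∀ (n : ℕ), 2 ≤ n → ∀ (M : CollectibleMDP.{u, v} n), M.Undirected →
      ∀ (γ : ℝ), 0 < γ → γ < 1 →
      ∀ (tie : List (Fin n) → Finset (Fin n) → Fin n),
        (∀ h T, T.Nonempty → tie h T ∈ T) →
        α * n ≤ M.OPT γ →
        c * ((n : ℝ) ^ (-(1 / 2) : ℝ) / Real.log n ^ 2) * M.OPT γ ≤ M.NNRDFS γ tie) ∧
    (∃ c : ℝ, 0 < c ∧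
      ∀ (n : ℕ), 2 ≤ n → ∀ (M : CollectibleMDP.{u, v} n), M.Undirected →
      ∀ (γ : ℝ), 0 < γ → γ < 1 →
      ∀ (tie : List (Fin n) → Finset (Fin n) → Fin n),
        (∀ h T, T.Nonempty → tie h T ∈ T) →
        c * ((n : ℝ) ^ (-(2 / 3) : ℝ) / Real.log n ^ 2) * M.OPT γ ≤ M.NNRDFS γ tie) := by
  obtain ⟨c, hc, hbounds⟩ := mainTheorem1_general.{u, v}
  exact ⟨fun α hα => ⟨c * (√α / 2), by positivity, fun n hn M hM γ hγ hγ₁ tie htie hopt =>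
      (rpow_neg_half_div_sq_log_mul_le hn hc.le hα.le hopt).trans
        (hbounds n hn M hM γ hγ hγ₁ tie htie).1⟩,
    c / 4, by positivity, fun n hn M hM γ hγ hγ₁ tie htie =>
      (rpow_neg_two_thirds_div_sq_log_mul_le hn hc.le (RDTSP.opt_nonneg hγ.le _)).trans
        (hbounds n hn M hM γ hγ hγ₁ tie htie).2⟩
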